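/- Let $K=\{-163,-67,-43,-19,-11,-7,-3,-2,-1\}$, let $d\in K$, and let $\mathcal O=\mathcal O_{\mathbb Q(\sqrt d)}\subset\mathbb C$, that is, $\mathcal O=\mathbb Z[\frac{1+\sqrt d}{2}]$ if $d\equiv 1\pmod 4$ and $\mathcal O=\mathbb Z[\sqrt d]$ otherwise. Write $x\sim y$ if $x=uy$ for some unit $u$ of $\mathcal O$, and let $|z|=\sqrt{z\overline z}$ be the usual absolute value. Let $A(d)$ be the set of all $z\in\mathcal O\setminus\{0\}$ with $0\le\arg(z)<\theta_d$, where $\arg(z)\in[0,2\pi)$ is the argument of $z$ and $\theta_{-1}=\pi/2$, $\theta_{-3}=\pi/3$, and $\theta_d=\pi$ for the other $d\in K$; this set contains exactly one element of each class of associated nonzero elements. For $m\in\mathbb Z$ and $z\in\mathcal O\setminus\{0\}$ put \[\delta_m(z)=\sum_{x\mid z,\ x\in A(d)}|x|^m,\] and for an integer $n\ge 1$ put $I_n(z)=\delta_n(z)/|z|^n$. Elements $z,w\in\mathcal O\setminus\{0\}$ are called $n$-powerful friends if $I_n(z)=I_n(w)$ and $|z|\neq|w|$, and $z\in\mathcal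 O\setminus\{0\}$ is called $n$-powerfully solitary if it has no $n$-powerful friend in $\mathcal O\setminus\{0\}$. Then, for every integer $n\ge1$, every $d\in K$, all $z_1,z_2\in\mathcal O\setminus\{0\}$ and every prime $\pi$ of $\mathcal O$: (a) $I_n(z_1)\in[1,\infty)$, and $I_n(z_1)=1$ if and only if $z_1$ is a unit of $\mathcal O$. If $n$ is even, then $I_n(z_1)\in\mathbb Q$. (b) $I_n$ is multiplicative: if $x,y\in\mathcal O\setminus\{0\}$ have no nonunit common divisor, then $I_n(xy)=I_n(x)I_n(y)$. (c) $I_n(z_1)=\delta_{-n}(z_1)$. (d) If $z_1\mid z_2$ in $\mathcal O$, then $I_n(z_1)\le I_n(z_2)$, with equality if and only if $z_1\sim z_2$. (e) If $z_1\sim\pi^k$ for a nonnegative integer $k$, then $z_1$ is $n$-powerfully solitary (for even and for odd $n$). -/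

import Mathlib

namespace QuadAbundancy

/-- The nine negative square-free integers `d` considered. -/
def K : Set ℤ := {-163, -67, -43, -19, -11, -7, -3, -2, -1}

/-- The square root of a negative integer `d` in the upper half plane. -/
noncomputable def sqrtNeg (d : ℤ) : ℂ := Complex.I * (Real.sqrt (-(d : ℝ)) : ℂ)

/-- The quadratic integer ring, as a subring of `ℂ`: `ℤ[(1 + √d) / 2]` if `d ≡ 1 mod 4`, and
`ℤ[√d]` otherwise. -/
noncomputable def quadRing (d : ℤ) : Subalgebra ℤ ℂ :=
  if d % 4 = 1 then Algebra.adjoin ℤ {(1 + sqrtNeg d) / 2} else Algebra.adjoin ℤ {sqrtNeg d}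

/-- The absolute value `|z| = √(z z̄)`, which is the usual one of complex numbers. -/
noncomputable def absVal {d : ℤ} (z : quadRing d) : ℝ := ‖(z : ℂ)‖

/-- The upper bound for the arguments of the chosen representatives of the classes of associates. -/
noncomputable def argBound (d : ℤ) : ℝ :=
  if d = -1 then Real.pi / 2 else if d = -3 then Real.pi / 3 else Real.pi

/-- The set `A(d)`, with one representative of each class of associated nonzero elements.
As the bound is at most `π`, it does not matter here that `Complex.arg` takes its values in
`(-π, π]` and not in `[0, 2π)`. -/
def A (d : ℤ) : Set (quadRing d) :=
  {z | z ≠ 0 ∧ 0 ≤ Complex.arg (z : ℂ) ∧ Complex.arg (z : ℂ) < argBound d}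

/-- `δ_n(z)`, the sum of `|x| ^ n` over the divisors `x ∈ A(d)` of `z`
(there are finitely many of them when `z ≠ 0` and `d < 0`). -/
noncomputable def delta {d : ℤ} (n : ℤ) (z : quadRing d) : ℝ :=
  ∑ᶠ x ∈ {x : quadRing d | x ∣ z ∧ x ∈ A d}, absVal x ^ n

/-- `I_n(z) = δ_n(z) / |z| ^ n`. -/
noncomputable def abundancy {d : ℤ} (n : ℕ) (z : quadRing d) : ℝ :=
  delta (n : ℤ) z / absVal z ^ n

/-- Multiplicativity of a function on the nonzero elements. `IsRelPrime x y` says that every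
common divisor of `x` and `y` is a unit. -/
def IsMultiplicative {d : ℤ} (f : quadRing d → ℝ) : Prop :=
  ∀ x y : quadRing d, x ≠ 0 → y ≠ 0 → IsRelPrime x y → f (x * y) = f x * f y

/-- Two nonzero elements are `n`-powerful friends. -/
def PowerfulFriends {d : ℤ} (n : ℕ) (z w : quadRing d) : Prop :=
  z ≠ 0 ∧ w ≠ 0 ∧ abundancy n z = abundancy n w ∧ absVal z ≠ absVal w

/-- A nonzero element is `n`-powerfully solitary if it has no `n`-powerful friend. -/
def PowerfullySolitary {d : ℤ} (n : ℕ) (z : quadRing d) : Prop :=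
  z ≠ 0 ∧ ¬ ∃ w : quadRing d, PowerfulFriends n z w

end QuadAbundancy

/-! Modulo units, `quadRing d` becomes a monoid with unique factorization and trivial units, and `A
d` picks one element per class. So `delta` is a divisor sum on `Associates` (`delta_eq_divisorSum`),
and (a)–(d) are the classical facts about divisor sums. Unique factorization rests on
`isPrincipalIdealRing`, proved by a Dedekind–Hasse type argument.

For (e), let `w` have the same abundancy as `p ^ k`. Since `δ_n(p ^ k) ≡ 1` modulo `|p| ^ n` among
algebraic integers, clearing denominators shows that `N(p) ^ k` divides `N(w)`; this also works for
odd `n`, where the absolute values may be irrational. Unique factorization applied to `w * conj w`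
then gives a divisor of `w`, built from `p` and its conjugate, with absolute value `|p| ^ k` and
abundancy at least that of `w`. By strict monotonicity it is associated to `w`. -/

namespace QuadAbundancy

/-! ### Divisor sums in a factorial monoid with trivial units. -/

section DivisorSum

variable {M : Type*} [CommMonoidWithZero M]

/-- The sum of `f x ^ m` over all divisors `x` of `z`. -/
noncomputable def divisorSum (f : M →*₀ ℝ) (m : ℤ) (z : M) : ℝ :=
  ∑ᶠ x ∈ {x : M | x ∣ z}, f x ^ m

theorem divisorSum_one [Subsingleton Mˣ] (f : M →*₀ ℝ) (m : ℤ) : divisorSum f m 1 = 1 := by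
  have : {x : M | x ∣ 1} = {1} := by
    ext x
    simp [← isUnit_iff_dvd_one]
  rw [divisorSum, this, finsum_mem_singleton, map_one, one_zpow]

variable [UniqueFactorizationMonoid M] [Subsingleton Mˣ] (f : M →*₀ ℝ)

theorem finite_setOf_dvd {z : M} (hz : z ≠ 0) : {x : M | x ∣ z}.Finite := by
  have hU : Fintype Mˣ := Fintype.ofSubsingleton 1
  have hF := UniqueFactorizationMonoid.fintypeSubtypeDvd z hz
  exact @Set.toFinite M {x : M | x ∣ z} (@Finite.of_fintype _ hF)

theorem divisorSum_eq_sum (m : ℤ) {z : M} (hz : z ≠ 0) :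
    divisorSum f m z = ∑ x ∈ (finite_setOf_dvd hz).toFinset, f x ^ m := by
  rw [divisorSum, finsum_mem_eq_finite_toFinset_sum _ (finite_setOf_dvd hz)]

/-- The passage to the complementary divisor is an involution on the divisors of `z`; `c` is that
involution. -/
theorem divisorSum_div_pow (hf : ∀ x, x ≠ 0 → f x ≠ 0) (n : ℕ) {z : M} (hz : z ≠ 0) :
    divisorSum f n z / f z ^ n = divisorSum f (-n) z := by
  have hfz : f z ≠ 0 := hf z hz
  have hex : ∀ x ∈ {x : M | x ∣ z}, ∃ y, z = x * y := fun x hx => hx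
  choose! c hc using hex
  have hc0 : ∀ x ∈ {x : M | x ∣ z}, x ≠ 0 := fun x hx h => hz (zero_dvd_iff.1 (h ▸ hx))
  have hcz : ∀ x ∈ {x : M | x ∣ z}, c x ∣ z := fun x hx => ⟨x, by rw [mul_comm]; exact hc x hx⟩
  have hcc : ∀ x ∈ {x : M | x ∣ z}, c (c x) = x := by
    intro x hx
    apply mul_left_cancel₀ (hc0 _ (hcz x hx))
    rw [← hc _ (hcz x hx), mul_comm]
    exact hc x hx
  rw [divisorSum_eq_sum f _ hz, divisorSum_eq_sum f _ hz, Finset.sum_div]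
  refine Finset.sum_bij' (fun x _ => c x) (fun x _ => c x) ?_ ?_ ?_ ?_ ?_
  · simpa using hcz
  · simpa using hcz
  · simpa using hcc
  · simpa using hcc
  · intro x hx
    have hx' : x ∣ z := by simpa using hx
    have h1 : f z = f x * f (c x) := by rw [← map_mul, ← hc x hx']
    have h2 : f x ≠ 0 := hf _ (hc0 x hx')
    have h3 : f (c x) ≠ 0 := hf _ (hc0 _ (hcz x hx'))
    rw [h1, zpow_natCast, zpow_neg, zpow_natCast, mul_pow]
    field_simp

theorem divisorSum_mul (m : ℤ) {x y : M} (hx : x ≠ 0) (hy : y ≠ 0) (h : IsRelPrime x y) :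
    divisorSum f m (x * y) = divisorSum f m x * divisorSum f m y := by
  rw [divisorSum_eq_sum f _ hx, divisorSum_eq_sum f _ hy, divisorSum_eq_sum f _ (mul_ne_zero hx hy),
    Finset.sum_mul_sum, ← Finset.sum_product']
  symm
  -- Used in both directions, this makes the factorization of a divisor of `x * y` unique.
  have key : ∀ a b a' b' : M, a ∣ x → b' ∣ y → a * b = a' * b' → a ∣ a' := by
    intro a b a' b' ha hb' e
    have hr : IsRelPrime a b' := (h.of_dvd_left ha).of_dvd_right hb'
    exact hr.dvd_of_dvd_mul_right (e ▸ dvd_mul_right a b)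
  refine Finset.sum_bij (fun p _ => p.1 * p.2) ?_ ?_ ?_ ?_
  · rintro ⟨a, b⟩ hab
    simp only [Finset.mem_product, Set.Finite.mem_toFinset, Set.mem_ofPred_eq] at hab ⊢
    exact mul_dvd_mul hab.1 hab.2
  · rintro ⟨a, b⟩ hab ⟨a', b'⟩ hab' e
    simp only [Finset.mem_product, Set.Finite.mem_toFinset, Set.mem_ofPred_eq] at hab hab' e
    have e1 : a = a' := dvd_antisymm' (key a' b' a b hab'.1 hab.2 e.symm)
      (key a b a' b' hab.1 hab'.2 e)
    subst e1
    have ha0 : a ≠ 0 := fun h0 => hx (zero_dvd_iff.1 (h0 ▸ hab.1))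
    rw [mul_left_cancel₀ ha0 e]
  · intro c hc
    simp only [Set.Finite.mem_toFinset, Set.mem_ofPred_eq] at hc
    obtain ⟨a, b, ha, hb, rfl⟩ := exists_dvd_and_dvd_of_dvd_mul hc
    exact ⟨(a, b), by simp [ha, hb], rfl⟩
  · rintro ⟨a, b⟩ -
    simp [mul_zpow]

theorem divisorSum_prime_pow (m : ℤ) {p : M} (hp : Prime p) (k : ℕ) :
    divisorSum f m (p ^ k) = ∑ j ∈ Finset.range (k + 1), (f p ^ m) ^ j := by
  rw [divisorSum_eq_sum f _ (pow_ne_zero k hp.ne_zero)]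
  symm
  refine Finset.sum_bij (fun j _ => p ^ j) ?_ ?_ ?_ ?_
  · intro j hj
    simp only [Set.Finite.mem_toFinset, Set.mem_ofPred_eq]
    exact pow_dvd_pow p (Nat.lt_succ_iff.1 (Finset.mem_range.1 hj))
  · intro i _ j _ e
    exact pow_injective_of_not_isUnit hp.not_isUnit hp.ne_zero e
  · intro c hc
    simp only [Set.Finite.mem_toFinset, Set.mem_ofPred_eq] at hc
    obtain ⟨i, hi, h⟩ := (dvd_prime_pow hp k).1 hc
    exact ⟨i, Finset.mem_range.2 (Nat.lt_succ_iff.2 hi), (associated_iff_eq.1 h).symm⟩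
  · intro j _
    rw [map_pow, ← zpow_natCast, ← zpow_natCast, ← zpow_mul, ← zpow_mul, mul_comm]

/-- All terms are positive, and `w` itself is an extra term unless `w = z`. -/
theorem divisorSum_mono (hf : ∀ x, x ≠ 0 → 0 < f x) (m : ℤ) {z w : M} (hz : z ≠ 0) (hw : w ≠ 0)
    (h : z ∣ w) : divisorSum f m z ≤ divisorSum f m w ∧
      (divisorSum f m z = divisorSum f m w ↔ z = w) := by
  have hsub : (finite_setOf_dvd hz).toFinset ⊆ (finite_setOf_dvd hw).toFinset := by
    intro x hx
    simp only [Set.Finite.mem_toFinset, Set.mem_ofPred_eq] at hx ⊢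
    exact hx.trans h
  have hpos : ∀ x ∈ (finite_setOf_dvd hw).toFinset, 0 < f x ^ m := by
    intro x hx
    simp only [Set.Finite.mem_toFinset, Set.mem_ofPred_eq] at hx
    exact zpow_pos (hf x fun h0 => hw (zero_dvd_iff.1 (h0 ▸ hx))) m
  refine ⟨?_, fun e => ?_, fun e => by rw [e]⟩
  · rw [divisorSum_eq_sum f _ hz, divisorSum_eq_sum f _ hw]
    exact Finset.sum_le_sum_of_subset_of_nonneg hsub fun x hx _ => (hpos x hx).le
  · by_contra hne
    have hmem : w ∈ (finite_setOf_dvd hw).toFinset := by simp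
    have hnm : w ∉ (finite_setOf_dvd hz).toFinset := by
      simp only [Set.Finite.mem_toFinset, Set.mem_ofPred_eq]
      exact fun h' => hne (dvd_antisymm' h' h)
    rw [divisorSum_eq_sum f _ hz, divisorSum_eq_sum f _ hw] at e
    exact (Finset.sum_lt_sum_of_subset hsub hmem hnm (hpos w hmem)
      fun x hx _ => (hpos x hx).le).ne e

end DivisorSum

/-! ### Integral basis, norm form and conjugation. -/

section Ring

/-- The trace of the generator `gen d` of the quadratic ring. -/
def genTrace (d : ℤ) : ℤ := if d % 4 = 1 then 1 else 0

/-- The norm of the generator `gen d` of the quadratic ring. -/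
def genNorm (d : ℤ) : ℤ := if d % 4 = 1 then (1 - d) / 4 else -d

/-- The generator of the quadratic ring. -/
noncomputable def gen (d : ℤ) : ℂ := if d % 4 = 1 then (1 + sqrtNeg d) / 2 else sqrtNeg d

variable {d : ℤ}

theorem neg_of_mem_K (hd : d ∈ K) : d < 0 := by
  simp only [K, Set.mem_insert_iff, Set.mem_singleton_iff] at hd
  omega

theorem gen_re (d : ℤ) : (gen d).re = genTrace d / 2 := by
  unfold gen genTrace sqrtNeg
  split_ifs <;> simp

theorem gen_im_pos (hd : d < 0) : 0 < (gen d).im := by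
  have h : 0 < Real.sqrt (-(d : ℝ)) := Real.sqrt_pos.2 (by simpa using hd)
  unfold gen sqrtNeg
  split_ifs <;> simp [h]

/-- Four times this is the absolute discriminant, the quantity bounded in the proof of principality.
-/
theorem gen_im_sq (hd : d < 0) : (gen d).im ^ 2 = genNorm d - (genTrace d : ℝ) ^ 2 / 4 := by
  have h : Real.sqrt (-(d : ℝ)) ^ 2 = -d := Real.sq_sqrt (by simpa using hd.le)
  unfold gen genNorm genTrace sqrtNeg
  split_ifs with h4
  · have h5 : (((1 - d) / 4 : ℤ) : ℝ) = (1 - d) / 4 := by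
      have : (4 : ℤ) ∣ 1 - d := by omega
      rw [Int.cast_div this (by norm_num)]
      push_cast
      ring
    rw [h5]
    simp [div_pow, h]
    ring
  · simp [h]

theorem gen_sq (hd : d < 0) : gen d ^ 2 = genTrace d * gen d - genNorm d := by
  have h1 := gen_re d
  have h2 := gen_im_sq hd
  apply Complex.ext
  · simp [pow_two, h1]
    linear_combination -h2
  · simp [pow_two, h1]
    ring

theorem quadRing_eq_adjoin (d : ℤ) : quadRing d = Algebra.adjoin ℤ {gen d} := by
  unfold quadRing gen
  split_ifs <;> rfl

theorem mem_quadRing_iff (hd : d < 0) {z : ℂ} :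
    z ∈ quadRing d ↔ ∃ a b : ℤ, z = a + b * gen d := by
  rw [quadRing_eq_adjoin]
  constructor
  · intro h
    induction h using Algebra.adjoin_induction with
    | mem x hx => exact ⟨0, 1, by simpa using hx⟩
    | algebraMap r => exact ⟨r, 0, by simp⟩
    | add x y _ _ hx hy =>
      obtain ⟨a, b, rfl⟩ := hx
      obtain ⟨a', b', rfl⟩ := hy
      exact ⟨a + a', b + b', by push_cast; ring⟩
    | mul x y _ _ hx hy =>
      obtain ⟨a, b, rfl⟩ := hx
      obtain ⟨a', b', rfl⟩ := hy
      refine ⟨a * a' - genNorm d * b * b', a * b' + a' * b + genTrace d * b * b', ?_⟩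
      push_cast
      linear_combination (b * b' : ℂ) * gen_sq hd
  · rintro ⟨a, b, rfl⟩
    have hg : gen d ∈ Algebra.adjoin ℤ {gen d} := Algebra.self_mem_adjoin_singleton ℤ _
    exact add_mem (intCast_mem _ a) (mul_mem (intCast_mem _ b) hg)

/-- The norm form of the quadratic ring. -/
def normForm (d a b : ℤ) : ℤ := a ^ 2 + genTrace d * a * b + genNorm d * b ^ 2

theorem normSq_add_mul_gen (hd : d < 0) (a b : ℝ) :
    Complex.normSq (a + b * gen d) = a ^ 2 + genTrace d * a * b + genNorm d * b ^ 2 := by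
  rw [Complex.normSq_apply]
  simp [gen_re]
  linear_combination (b ^ 2 : ℝ) * gen_im_sq hd

theorem normSq_eq_normForm (hd : d < 0) (a b : ℤ) :
    Complex.normSq (a + b * gen d) = normForm d a b := by
  have := normSq_add_mul_gen hd a b
  push_cast at this
  rw [this, normForm]
  push_cast
  ring

theorem exists_normSq_eq (hd : d < 0) (z : quadRing d) :
    ∃ N : ℕ, Complex.normSq (z : ℂ) = N := by
  obtain ⟨a, b, h⟩ := (mem_quadRing_iff hd).1 z.2
  have h1 : Complex.normSq (z : ℂ) = normForm d a b := by rw [h, normSq_eq_normForm hd]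
  have h2 : 0 ≤ normForm d a b := by
    have := Complex.normSq_nonneg (z : ℂ)
    rw [h1] at this
    exact_mod_cast this
  refine ⟨(normForm d a b).toNat, ?_⟩
  rw [h1]
  exact_mod_cast (Int.toNat_of_nonneg h2).symm

theorem conj_gen (d : ℤ) : (starRingEnd ℂ) (gen d) = genTrace d - gen d := by
  apply Complex.ext
  · simp [gen_re]
    ring
  · simp

theorem conj_mem (hd : d < 0) {z : ℂ} (hz : z ∈ quadRing d) :
    (starRingEnd ℂ) z ∈ quadRing d := by
  obtain ⟨a, b, rfl⟩ := (mem_quadRing_iff hd).1 hz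
  refine (mem_quadRing_iff hd).2 ⟨a + b * genTrace d, -b, ?_⟩
  simp [conj_gen]
  ring

/-- Complex conjugation on the quadratic ring. -/
noncomputable def conjEquiv (hd : d < 0) : quadRing d ≃+* quadRing d where
  toFun z := ⟨(starRingEnd ℂ) z, conj_mem hd z.2⟩
  invFun z := ⟨(starRingEnd ℂ) z, conj_mem hd z.2⟩
  left_inv z := by ext; simp
  right_inv z := by ext; simp
  map_mul' x y := by ext; simp
  map_add' x y := by ext; simp

@[simp]
theorem coe_conjEquiv (hd : d < 0) (z : quadRing d) :
    (conjEquiv hd z : ℂ) = (starRingEnd ℂ) (z : ℂ) := rfl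

theorem conjEquiv_conjEquiv (hd : d < 0) (z : quadRing d) :
    conjEquiv hd (conjEquiv hd z) = z := by
  ext
  simp

theorem mul_conjEquiv (hd : d < 0) (z : quadRing d) {N : ℕ} (hN : Complex.normSq (z : ℂ) = N) :
    z * conjEquiv hd z = N := by
  ext
  simp [Complex.mul_conj, hN]

end Ring

/-! ### Class number one. -/

section Principal

variable {d : ℤ}

theorem dvd_of_dvd_normForm (p : ℕ)
    (h : ∀ a b : ZMod p, a ^ 2 + (genTrace d : ZMod p) * a * b + (genNorm d : ZMod p) * b ^ 2 = 0 →
      a = 0 ∧ b = 0) (a b : ℤ) (hp : (p : ℤ) ∣ normForm d a b) : (p : ℤ) ∣ a ∧ (p : ℤ) ∣ b := by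
  rw [← ZMod.intCast_zmod_eq_zero_iff_dvd] at hp
  have := h a b (by rw [← hp, normForm]; push_cast; ring)
  rwa [ZMod.intCast_zmod_eq_zero_iff_dvd, ZMod.intCast_zmod_eq_zero_iff_dvd] at this

/-- All primes up to a bound of the size of Minkowski's are inert. -/
theorem exists_inert_bound (hd : d ∈ K) : ∃ B : ℕ, 0 < B ∧
    4 * genNorm d - genTrace d ^ 2 < 3 * ((B : ℤ) + 1) ^ 2 ∧
    ∀ p : ℕ, p.Prime → p ≤ B → ∀ a b : ℤ, (p : ℤ) ∣ normForm d a b → (p : ℤ) ∣ a ∧ (p : ℤ) ∣ b := by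
  have small : 4 * genNorm d - genTrace d ^ 2 < 12 → ∃ B : ℕ, 0 < B ∧
      4 * genNorm d - genTrace d ^ 2 < 3 * ((B : ℤ) + 1) ^ 2 ∧
      ∀ p : ℕ, p.Prime → p ≤ B → ∀ a b : ℤ, (p : ℤ) ∣ normForm d a b →
        (p : ℤ) ∣ a ∧ (p : ℤ) ∣ b := fun h =>
    ⟨1, one_pos, by norm_num; exact h, fun p hp h1 => absurd h1 (by have := hp.two_le; omega)⟩
  simp only [K, Set.mem_insert_iff, Set.mem_singleton_iff] at hd
  rcases hd with rfl | rfl | rfl | rfl | rfl | rfl | rfl | rfl | rfl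
  -- In each case `B` is the least value allowed by the discriminant bound; inertness is a finite
  -- check that the norm form is anisotropic modulo `p`.
  · refine ⟨7, by norm_num, by decide, fun p hp hB => dvd_of_dvd_normForm p ?_⟩
    interval_cases p <;> first | (revert hp; norm_num; done) | decide
  · refine ⟨4, by norm_num, by decide, fun p hp hB => dvd_of_dvd_normForm p ?_⟩
    interval_cases p <;> first | (revert hp; norm_num; done) | decide
  · refine ⟨3, by norm_num, by decide, fun p hp hB => dvd_of_dvd_normForm p ?_⟩
    interval_cases p <;> first | (revert hp; norm_num; done) | decide
  · refine ⟨2, by norm_num, by decide, fun p hp hB => dvd_of_dvd_normForm p ?_⟩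
    interval_cases p <;> first | (revert hp; norm_num; done) | decide
  all_goals exact small (by decide)

/-- Dirichlet approximation brings the `gen d`-coordinate of `m ξ` within `1 / (B + 1)` of an
integer, which contributes less than `3 / 4` to the norm; rounding the real part contributes at most
`1 / 4`. -/
theorem normSq_lt_one_of_approx (hd : d < 0) {B : ℕ}
    (hB : 4 * genNorm d - genTrace d ^ 2 < 3 * ((B : ℤ) + 1) ^ 2) (ξ : ℂ) (hB0 : 0 < B) :
    ∃ m : ℕ, 0 < m ∧ m ≤ B ∧ ∃ a b : ℤ, Complex.normSq (m * ξ - (a + b * gen d)) < 1 := by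
  have hpos := gen_im_pos hd
  obtain ⟨m, hm, hmB, h⟩ := Real.exists_nat_abs_mul_sub_round_le (ξ.im / (gen d).im) hB0
  set b := round (m * (ξ.im / (gen d).im)) with hb
  refine ⟨m, hm, hmB, round (m * ξ.re - b * (gen d).re), b, ?_⟩
  have h1 := abs_sub_round (m * ξ.re - b * (gen d).re)
  set a := round (m * ξ.re - b * (gen d).re) with ha
  have hB1 : (0 : ℝ) < B + 1 := by positivity
  have hre : (m * ξ - (a + b * gen d)).re = m * ξ.re - b * (gen d).re - a := by simp; ring
  have him : (m * ξ - (a + b * gen d)).im =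
      (m * (ξ.im / (gen d).im) - b) * (gen d).im := by simp; field_simp
  rw [Complex.normSq_apply, hre, him]
  have e1 : (m * ξ.re - b * (gen d).re - a) ^ 2 ≤ (1 / 2) ^ 2 :=
    sq_le_sq' (abs_le.1 h1).1 (abs_le.1 h1).2
  have e2 : (m * (ξ.im / (gen d).im) - b) ^ 2 ≤ (1 / ((B : ℝ) + 1)) ^ 2 :=
    sq_le_sq' (abs_le.1 h).1 (abs_le.1 h).2
  have e3 : (gen d).im ^ 2 < 3 / 4 * ((B : ℝ) + 1) ^ 2 := by
    have : (4 * genNorm d - genTrace d ^ 2 : ℝ) < 3 * ((B : ℝ) + 1) ^ 2 := by exact_mod_cast hB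
    rw [gen_im_sq hd]
    linarith
  have e4 : (m * (ξ.im / (gen d).im) - b) ^ 2 * (gen d).im ^ 2 < 3 / 4 := by
    calc _ ≤ (1 / ((B : ℝ) + 1)) ^ 2 * (gen d).im ^ 2 := by gcongr
      _ < (1 / ((B : ℝ) + 1)) ^ 2 * (3 / 4 * ((B : ℝ) + 1) ^ 2) := by gcongr
      _ = 3 / 4 := by field_simp
  nlinarith

/-- If `b` has minimal norm in an ideal and all prime factors of `m` are inert, then `b` divides
every `a` in the ideal for which it divides `m a`. -/
theorem dvd_of_dvd_natCast_mul (hd : d < 0) {I : Ideal (quadRing d)} {b : quadRing d} (hbI : b ∈ I)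
    (hb0 : b ≠ 0) (hmin : ∀ x ∈ I, Complex.normSq (x : ℂ) < Complex.normSq (b : ℂ) → x = 0)
    (m : ℕ) (hm : 0 < m)
    (hp : ∀ p : ℕ, p.Prime → p ∣ m → ∀ a b : ℤ, (p : ℤ) ∣ normForm d a b →
      (p : ℤ) ∣ a ∧ (p : ℤ) ∣ b) :
    ∀ a ∈ I, b ∣ m * a → b ∣ a := by
  induction m using Nat.recOnMul with
  | zero => omega
  | one => simp
  | mul m₁ m₂ ih₁ ih₂ =>
    intro a ha h
    have h1 : 0 < m₁ := Nat.pos_of_mul_pos_right hm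
    have h2 : 0 < m₂ := Nat.pos_of_mul_pos_left hm
    refine ih₂ h2 (fun p pp hpm => hp p pp (hpm.mul_left _)) a ha
      (ih₁ h1 (fun p pp hpm => hp p pp (hpm.mul_right _)) _ (I.mul_mem_left _ ha) ?_)
    rw [← mul_assoc]
    exact_mod_cast h
  | prime p pp =>
    rintro a ha ⟨β, hβ⟩
    have hp0 : (p : quadRing d) ≠ 0 := by exact_mod_cast pp.ne_zero
    obtain ⟨u, v, huv⟩ := (mem_quadRing_iff hd).1 β.2
    obtain ⟨N, hN⟩ := exists_normSq_eq hd β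
    have hN' : (N : ℤ) = normForm d u v := by
      have := normSq_eq_normForm hd u v
      rw [← huv, hN] at this
      exact_mod_cast this
    by_cases hpN : (p : ℤ) ∣ N
    · obtain ⟨⟨u', rfl⟩, ⟨v', rfl⟩⟩ := hp p pp dvd_rfl u v (hN' ▸ hpN)
      refine ⟨⟨u' + v' * gen d, (mem_quadRing_iff hd).2 ⟨u', v', rfl⟩⟩, ?_⟩
      apply mul_left_cancel₀ hp0
      rw [hβ]
      ext
      simp only [MulMemClass.coe_mul, huv]
      push_cast
      ring
    · exfalso
      have hco : IsCoprime (p : ℤ) N :=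
        (Int.prime_iff_natAbs_prime.2 (by simpa using pp)).coprime_iff_not_dvd.2 hpN
      obtain ⟨s, r, hsr⟩ := hco
      -- By Bézout, `e` is `b / p`: a nonzero element of the ideal with norm smaller than that of
      -- `b`.
      set e : quadRing d := s * b + r * (conjEquiv hd β * a) with he
      have heI : e ∈ I := I.add_mem (I.mul_mem_left _ hbI)
        (I.mul_mem_left _ (I.mul_mem_left _ ha))
      have hpe : p * e = b := by
        have h1 : (s * p + r * N : quadRing d) = 1 := by exact_mod_cast congrArg (Int.cast) hsr
        have h2 := mul_conjEquiv hd β hN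
        rw [he]
        linear_combination b * h1 + r * conjEquiv hd β * hβ + r * b * h2
      have he0 : e ≠ 0 := by
        rintro h0
        rw [h0, mul_zero] at hpe
        exact hb0 hpe.symm
      refine he0 (hmin e heI ?_)
      have h3 : 0 < Complex.normSq (e : ℂ) := Complex.normSq_pos.2 (by simpa using he0)
      rw [← hpe]
      simp only [MulMemClass.coe_mul, Complex.normSq_mul]
      have h4 : Complex.normSq ((p : quadRing d) : ℂ) = p * p := by simp
      have h5 : (2 : ℝ) ≤ p := by exact_mod_cast pp.two_le
      rw [h4]
      exact lt_mul_of_one_lt_left h3 (by nlinarith)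

theorem isPrincipalIdealRing (hd : d ∈ K) : IsPrincipalIdealRing (quadRing d) := by
  have hd0 := neg_of_mem_K hd
  refine ⟨fun I => ?_⟩
  by_cases hI : I = ⊥
  · exact ⟨0, by simp [hI]⟩
  obtain ⟨b₀, hb₀, hb₀0⟩ := Submodule.exists_mem_ne_zero_of_ne_bot hI
  choose N hN using exists_normSq_eq hd0
  obtain ⟨b, ⟨hbI, hb0⟩, hb⟩ :=
    (measure N).wf.has_min {x : quadRing d | x ∈ I ∧ x ≠ 0} ⟨b₀, hb₀, hb₀0⟩
  have hmin : ∀ x ∈ I, Complex.normSq (x : ℂ) < Complex.normSq (b : ℂ) → x = 0 := by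
    intro x hx h
    by_contra hx0
    rw [hN, hN] at h
    exact hb x ⟨hx, hx0⟩ (by exact_mod_cast h)
  obtain ⟨B, hB0, hB, hinert⟩ := exists_inert_bound hd
  have hbC : (b : ℂ) ≠ 0 := by simpa using hb0
  refine ⟨b, le_antisymm (fun a ha => ?_) ((Ideal.span_singleton_le_iff_mem I).2 hbI)⟩
  refine Ideal.mem_span_singleton.2 ?_
  obtain ⟨m, hm, hmB, u, v, huv⟩ := normSq_lt_one_of_approx hd0 hB ((a : ℂ) / b) hB0
  set γ : quadRing d := ⟨u + v * gen d, (mem_quadRing_iff hd0).2 ⟨u, v, rfl⟩⟩ with hγ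
  -- Since `γ` approximates `m a / b` with error below `1`, this element of `I` has norm below the
  -- minimum.
  have hr : (m * a - γ * b : quadRing d) = 0 := by
    refine hmin _ (I.sub_mem (I.mul_mem_left _ ha) (I.mul_mem_left _ hbI)) ?_
    have e : ((m * a - γ * b : quadRing d) : ℂ) = (m * ((a : ℂ) / b) - (u + v * gen d)) * b := by
      push_cast
      field_simp
      simp [hγ]
      ring
    rw [e, Complex.normSq_mul]
    exact mul_lt_of_lt_one_left (Complex.normSq_pos.2 hbC) huv
  refine dvd_of_dvd_natCast_mul hd0 hbI hb0 hmin m hm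
    (fun p pp hpm => hinert p pp ((Nat.le_of_dvd hm hpm).trans hmB)) a ha ⟨γ, ?_⟩
  rw [sub_eq_zero.1 hr, mul_comm]

end Principal

/-! ### The sector `A d` represents the classes of associates. -/

section Representatives

variable {d : ℤ}

theorem isUnit_of_norm_eq_one (hd : d < 0) {z : quadRing d} (hz : ‖(z : ℂ)‖ = 1) : IsUnit z := by
  refine IsUnit.of_mul_eq_one (conjEquiv hd z) ?_
  have : Complex.normSq (z : ℂ) = (1 : ℕ) := by rw [Complex.normSq_eq_norm_sq, hz]; simp
  simpa using mul_conjEquiv hd z this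

theorem norm_eq_one_of_isUnit (hd : d < 0) {z : quadRing d} (hz : IsUnit z) : ‖(z : ℂ)‖ = 1 := by
  obtain ⟨y, hy⟩ := hz.exists_right_inv
  obtain ⟨N, hN⟩ := exists_normSq_eq hd z
  obtain ⟨N', hN'⟩ := exists_normSq_eq hd y
  have h : N * N' = 1 := by
    have : Complex.normSq ((z * y : quadRing d) : ℂ) = 1 := by simp [hy]
    simp only [MulMemClass.coe_mul, Complex.normSq_mul, hN, hN'] at this
    exact_mod_cast this
  rw [Complex.normSq_eq_norm_sq, Nat.eq_one_of_mul_eq_one_right h] at hN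
  exact (pow_eq_one_iff_of_nonneg (norm_nonneg _) two_ne_zero).1 (by simpa using hN)

theorem argBound_pos (d : ℤ) : 0 < argBound d := by
  unfold argBound
  split_ifs <;> linarith [Real.pi_pos]

theorem argBound_le_pi (d : ℤ) : argBound d ≤ Real.pi := by
  unfold argBound
  split_ifs <;> linarith [Real.pi_pos]

theorem exp_argBound_mem (d : ℤ) : Complex.exp (argBound d * Complex.I) ∈ quadRing d := by
  have hg : gen d ∈ quadRing d := by
    rw [quadRing_eq_adjoin]
    exact Algebra.self_mem_adjoin_singleton ℤ _
  unfold argBound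
  split_ifs with h1 h2
  · subst h1
    convert hg using 1
    push_cast
    rw [Complex.exp_pi_div_two_mul_I]
    simp [gen, sqrtNeg]
  · subst h2
    convert hg using 1
    rw [Complex.exp_mul_I, ← Complex.ofReal_cos, ← Complex.ofReal_sin, Real.cos_pi_div_three,
      Real.sin_pi_div_three]
    simp [gen, sqrtNeg]
    ring
  · rw [Complex.exp_pi_mul_I]
    exact neg_mem (one_mem _)

theorem exp_int_mul_argBound_mem (hd : d < 0) (k : ℤ) :
    Complex.exp ((k * argBound d : ℝ) * Complex.I) ∈ quadRing d := by
  have h : ∀ n : ℕ, Complex.exp ((n * argBound d : ℝ) * Complex.I) ∈ quadRing d := by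
    intro n
    have := pow_mem (exp_argBound_mem d) n
    rw [← Complex.exp_nat_mul] at this
    convert this using 2
    push_cast
    ring
  obtain ⟨n, rfl | rfl⟩ := k.eq_nat_or_neg
  · exact_mod_cast h n
  · convert conj_mem hd (h n) using 1
    rw [← Complex.exp_conj]
    simp

/-- Rotation by the angle `argBound d` is multiplication by a unit, so the argument can be reduced
modulo `argBound d`. -/
theorem exists_mem_A_associated (hd : d < 0) {z : quadRing d} (hz : z ≠ 0) :
    ∃ x ∈ A d, Associated x z := by
  have hθ := argBound_pos d
  have hzC : (z : ℂ) ≠ 0 := by simpa using hz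
  set k := ⌊Complex.arg z / argBound d⌋ with hk
  have hk1 : k * argBound d ≤ Complex.arg z := by
    rw [← le_div_iff₀ hθ]
    exact Int.floor_le _
  have hk2 : Complex.arg z < (k + 1) * argBound d := by
    rw [← div_lt_iff₀ hθ]
    exact Int.lt_floor_add_one _
  set u : quadRing d := ⟨_, exp_int_mul_argBound_mem hd (-k)⟩ with hu
  have huu : IsUnit u := isUnit_of_norm_eq_one hd (by simp only [hu, Complex.norm_exp_ofReal_mul_I])
  have hx : ((z * u : quadRing d) : ℂ) = (‖(z : ℂ)‖ : ℂ) *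
      (Complex.cos (Complex.arg z - k * argBound d : ℝ) +
        Complex.sin (Complex.arg z - k * argBound d : ℝ) * Complex.I) := by
    rw [← Complex.exp_mul_I]
    simp only [hu, MulMemClass.coe_mul]
    conv_lhs => rw [← Complex.norm_mul_exp_arg_mul_I (z : ℂ)]
    rw [mul_assoc, ← Complex.exp_add]
    congr 2
    push_cast
    ring
  have harg : Complex.arg ((z * u : quadRing d) : ℂ) = Complex.arg z - k * argBound d := by
    rw [hx]
    refine Complex.arg_mul_cos_add_sin_mul_I (norm_pos_iff.2 hzC) ⟨?_, ?_⟩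
    · linarith [Real.pi_pos]
    · linarith [argBound_le_pi d]
  refine ⟨z * u, ⟨mul_ne_zero hz huu.ne_zero, ?_, ?_⟩, (associated_mul_unit_right z u huu).symm⟩
  · rw [harg]
    linarith
  · rw [harg]
    linarith

/-- An element of norm `1` above the real axis has `b ≥ 1`, which absolute discriminant at least `7`
rules out. For `-3` and `-1`, the comparison of cosines also bounds the real part from below, making
the norm exceed `1`. -/
theorem eq_zero_of_exp_mem (hd : d ∈ K) {φ : ℝ} (h0 : 0 ≤ φ) (h1 : φ < argBound d)
    (hu : Complex.exp (φ * Complex.I) ∈ quadRing d) : φ = 0 := by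
  by_contra hne
  have hd0 := neg_of_mem_K hd
  have hpos : 0 < φ := lt_of_le_of_ne h0 (Ne.symm hne)
  have hsin : 0 < Real.sin φ := Real.sin_pos_of_pos_of_lt_pi hpos (h1.trans_le (argBound_le_pi d))
  have hcos : Real.cos (argBound d) < Real.cos φ :=
    Real.cos_lt_cos_of_nonneg_of_le_pi h0 (argBound_le_pi d) h1
  obtain ⟨a, b, hab⟩ := (mem_quadRing_iff hd0).1 hu
  have hN : normForm d a b = 1 := by
    have h := normSq_eq_normForm hd0 a b
    rw [← hab, Complex.normSq_eq_norm_sq, Complex.norm_exp_ofReal_mul_I] at h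
    exact_mod_cast (by simpa using h.symm)
  have hb : 0 < b := by
    have h := congrArg Complex.im hab
    rw [Complex.exp_ofReal_mul_I_im] at h
    simp only [Complex.add_im, Complex.intCast_im, Complex.mul_im, Complex.intCast_re, zero_mul,
      zero_add, add_zero] at h
    rw [h] at hsin
    exact_mod_cast pos_of_mul_pos_left hsin (gen_im_pos hd0).le
  have hre : Real.cos φ = a + b * (genTrace d / 2) := by
    have h := congrArg Complex.re hab
    rw [Complex.exp_ofReal_mul_I_re] at h
    simpa [gen_re] using h
  rw [hre] at hcos
  have key : 7 ≤ 4 * genNorm d - genTrace d ^ 2 → False := by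
    intro h7
    unfold normForm at hN
    have : (2 * a + genTrace d * b) ^ 2 + (4 * genNorm d - genTrace d ^ 2) * b ^ 2 = 4 := by
      linear_combination 4 * hN
    nlinarith [sq_nonneg (2 * a + genTrace d * b)]
  simp only [K, Set.mem_insert_iff, Set.mem_singleton_iff] at hd
  rcases hd with rfl | rfl | rfl | rfl | rfl | rfl | rfl | rfl | rfl
  case inr.inr.inr.inr.inr.inr.inl =>
    have e1 : genTrace (-3) = 1 := by decide
    have e2 : genNorm (-3) = 1 := by decide
    have e3 : argBound (-3) = Real.pi / 3 := by norm_num [argBound]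
    rw [e1, e3, Real.cos_pi_div_three] at hcos
    have h2 : 1 < 2 * a + b := by
      have : (1 : ℝ) < 2 * a + b := by push_cast at hcos; linarith
      exact_mod_cast this
    simp only [normForm, e1, e2] at hN
    nlinarith
  case inr.inr.inr.inr.inr.inr.inr.inr =>
    have e1 : genTrace (-1) = 0 := by decide
    have e2 : genNorm (-1) = 1 := by decide
    have e3 : argBound (-1) = Real.pi / 2 := by norm_num [argBound]
    rw [e1, e3, Real.cos_pi_div_two] at hcos
    have h2 : 0 < a := by
      have : (0 : ℝ) < a := by simpa using hcos
      exact_mod_cast this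
    simp only [normForm, e1, e2] at hN
    nlinarith
  all_goals exact key (by decide)

theorem eq_of_mem_A_of_associated (hd : d ∈ K) {x y : quadRing d} (hx : x ∈ A d) (hy : y ∈ A d)
    (h : Associated x y) : x = y := by
  have hd0 := neg_of_mem_K hd
  wlog hle : Complex.arg x ≤ Complex.arg y generalizing x y
  · exact (this hy hx h.symm (le_of_not_ge hle)).symm
  obtain ⟨hx0, hx1, hx2⟩ := hx
  obtain ⟨hy0, hy1, hy2⟩ := hy
  obtain ⟨u, hu⟩ := h
  have hxC : (x : ℂ) ≠ 0 := by simpa using hx0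
  have hun : ‖((u : quadRing d) : ℂ)‖ = 1 := norm_eq_one_of_isUnit hd0 u.isUnit
  have huC : (x : ℂ) * (u : quadRing d) = y := by exact_mod_cast congrArg Subtype.val hu
  have hn : ‖(y : ℂ)‖ = ‖(x : ℂ)‖ := by rw [← huC, norm_mul, hun, mul_one]
  have he : ((u : quadRing d) : ℂ) =
      Complex.exp ((Complex.arg y - Complex.arg x : ℝ) * Complex.I) := by
    apply mul_left_cancel₀ hxC
    rw [huC]
    conv_lhs => rw [← Complex.norm_mul_exp_arg_mul_I (y : ℂ), hn]
    conv_rhs =>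
      arg 1
      rw [← Complex.norm_mul_exp_arg_mul_I (x : ℂ)]
    rw [mul_assoc, ← Complex.exp_add]
    congr 2
    push_cast
    ring
  have hφ : Complex.arg y - Complex.arg x = 0 :=
    eq_zero_of_exp_mem hd (by linarith) (by linarith) (he ▸ (u : quadRing d).2)
  ext
  rw [← huC, he, hφ]
  simp

/-- The absolute value on classes of associates. -/
noncomputable def assocAbs (hd : d < 0) : Associates (quadRing d) →*₀ ℝ where
  toFun := Quotient.lift (fun z : quadRing d => ‖(z : ℂ)‖) (by
    rintro x y ⟨u, rfl⟩
    simp [norm_eq_one_of_isUnit hd u.isUnit])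
  map_zero' := by
    change ‖((0 : quadRing d) : ℂ)‖ = 0
    simp
  map_one' := by
    change ‖((1 : quadRing d) : ℂ)‖ = 1
    simp
  map_mul' x y := by
    obtain ⟨x, rfl⟩ := Associates.mk_surjective x
    obtain ⟨y, rfl⟩ := Associates.mk_surjective y
    change ‖((x * y : quadRing d) : ℂ)‖ = ‖(x : ℂ)‖ * ‖(y : ℂ)‖
    simp

theorem assocAbs_mk (hd : d < 0) (z : quadRing d) : assocAbs hd (Associates.mk z) = absVal z := rfl

theorem assocAbs_pos (hd : d < 0) (x : Associates (quadRing d)) (hx : x ≠ 0) :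
    0 < assocAbs hd x := by
  obtain ⟨x, rfl⟩ := Associates.mk_surjective x
  rw [Associates.mk_ne_zero] at hx
  rw [assocAbs_mk]
  exact norm_pos_iff.2 (by simpa using hx)

theorem delta_eq_divisorSum (hd : d ∈ K) (m : ℤ) {z : quadRing d} (hz : z ≠ 0) :
    delta m z = divisorSum (assocAbs (neg_of_mem_K hd)) m (Associates.mk z) := by
  have hd0 := neg_of_mem_K hd
  refine finsum_mem_eq_of_bijOn Associates.mk ⟨?_, ?_, ?_⟩ fun x _ => rfl
  · rintro x ⟨hx, -⟩
    exact Associates.mk_dvd_mk.2 hx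
  · rintro x ⟨-, hx⟩ y ⟨-, hy⟩ h
    exact eq_of_mem_A_of_associated hd hx hy (Associates.mk_eq_mk_iff_associated.1 h)
  · intro c hc
    obtain ⟨c, rfl⟩ := Associates.mk_surjective c
    have hcz : c ∣ z := Associates.mk_dvd_mk.1 hc
    obtain ⟨x, hx, hxc⟩ := exists_mem_A_associated hd0 (ne_zero_of_dvd_ne_zero hz hcz)
    exact ⟨x, ⟨hxc.dvd.trans hcz, hx⟩, Associates.mk_eq_mk_iff_associated.2 hxc⟩

end Representatives

/-! ### Abundancy, and solitude of prime powers. -/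

section Abundancy

variable {d : ℤ}

theorem absVal_mul (x y : quadRing d) : absVal (x * y) = absVal x * absVal y := by
  simp [absVal]

theorem absVal_pow (x : quadRing d) (k : ℕ) : absVal (x ^ k) = absVal x ^ k := by
  simp [absVal]

theorem absVal_pos {x : quadRing d} (hx : x ≠ 0) : 0 < absVal x :=
  norm_pos_iff.2 (by simpa using hx)

theorem absVal_eq_of_associated (hd : d < 0) {x y : quadRing d} (h : Associated x y) :
    absVal x = absVal y := by
  rw [← assocAbs_mk hd, ← assocAbs_mk hd, Associates.mk_eq_mk_iff_associated.2 h]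

theorem absVal_conjEquiv (hd : d < 0) (x : quadRing d) : absVal (conjEquiv hd x) = absVal x := by
  simp [absVal]

theorem exists_absVal_sq_eq (hd : d < 0) (x : quadRing d) : ∃ N : ℕ, absVal x ^ 2 = N := by
  obtain ⟨N, hN⟩ := exists_normSq_eq hd x
  exact ⟨N, by rw [absVal, ← Complex.normSq_eq_norm_sq, hN]⟩

theorem isIntegral_absVal (hd : d < 0) (x : quadRing d) : IsIntegral ℤ (absVal x) := by
  obtain ⟨N, hN⟩ := exists_absVal_sq_eq hd x
  refine IsIntegral.of_pow two_pos ?_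
  rw [hN]
  exact isIntegral_natCast N

theorem abundancy_eq_divisorSum (hd : d ∈ K) (n : ℕ) {z : quadRing d} (hz : z ≠ 0) :
    abundancy n z = divisorSum (assocAbs (neg_of_mem_K hd)) (-n) (Associates.mk z) := by
  have := isPrincipalIdealRing hd
  rw [← divisorSum_div_pow _ (fun x hx => (assocAbs_pos _ x hx).ne') n (Associates.mk_ne_zero.2 hz),
    assocAbs_mk, ← delta_eq_divisorSum hd _ hz, abundancy]

theorem abundancy_eq_delta_neg (hd : d ∈ K) (n : ℕ) {z : quadRing d} (hz : z ≠ 0) :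
    abundancy n z = delta (-n) z := by
  rw [abundancy_eq_divisorSum hd n hz, delta_eq_divisorSum hd _ hz]

theorem abundancy_mul (hd : d ∈ K) (n : ℕ) {x y : quadRing d} (hx : x ≠ 0) (hy : y ≠ 0)
    (h : IsRelPrime x y) : abundancy n (x * y) = abundancy n x * abundancy n y := by
  have := isPrincipalIdealRing hd
  rw [abundancy_eq_divisorSum hd n hx, abundancy_eq_divisorSum hd n hy,
    abundancy_eq_divisorSum hd n (mul_ne_zero hx hy), ← Associates.mk_mul_mk]
  exact divisorSum_mul _ _ (Associates.mk_ne_zero.2 hx) (Associates.mk_ne_zero.2 hy)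
    (Associates.mk_isRelPrime_iff.2 h)

theorem abundancy_mono (hd : d ∈ K) (n : ℕ) {x y : quadRing d} (hx : x ≠ 0) (hy : y ≠ 0)
    (h : x ∣ y) : abundancy n x ≤ abundancy n y ∧
      (abundancy n x = abundancy n y ↔ Associated x y) := by
  have := isPrincipalIdealRing hd
  rw [abundancy_eq_divisorSum hd n hx, abundancy_eq_divisorSum hd n hy,
    ← Associates.mk_eq_mk_iff_associated]
  exact divisorSum_mono _ (assocAbs_pos _) _ (Associates.mk_ne_zero.2 hx)
    (Associates.mk_ne_zero.2 hy) (Associates.mk_dvd_mk.2 h)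

theorem abundancy_one (hd : d ∈ K) (n : ℕ) : abundancy n (1 : quadRing d) = 1 := by
  rw [abundancy_eq_divisorSum hd n one_ne_zero, Associates.mk_one, divisorSum_one]

theorem delta_prime_pow (hd : d ∈ K) (m : ℤ) {p : quadRing d} (hp : Prime p) (k : ℕ) :
    delta m (p ^ k) = ∑ j ∈ Finset.range (k + 1), (absVal p ^ m) ^ j := by
  have := isPrincipalIdealRing hd
  rw [delta_eq_divisorSum hd _ (pow_ne_zero k hp.ne_zero), Associates.mk_pow,
    divisorSum_prime_pow _ _ (Associates.prime_mk.2 hp), assocAbs_mk]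

theorem exists_rat_abundancy_eq (hd : d ∈ K) {n : ℕ} (hn : Even n) {z : quadRing d} (hz : z ≠ 0) :
    ∃ q : ℚ, abundancy n z = q := by
  have := isPrincipalIdealRing hd
  have hd0 := neg_of_mem_K hd
  have hmem : ∀ x : quadRing d, absVal x ^ n ∈ (algebraMap ℚ ℝ).fieldRange := by
    intro x
    obtain ⟨m, rfl⟩ := hn
    obtain ⟨N, hN⟩ := exists_absVal_sq_eq hd0 x
    rw [← two_mul, pow_mul, hN]
    exact pow_mem (natCast_mem _ N) m
  have h : abundancy n z ∈ (algebraMap ℚ ℝ).fieldRange := by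
    refine div_mem ?_ (hmem z)
    rw [delta_eq_divisorSum hd _ hz, divisorSum_eq_sum _ _ (Associates.mk_ne_zero.2 hz)]
    refine sum_mem fun x _ => ?_
    obtain ⟨x, rfl⟩ := Associates.mk_surjective x
    rw [assocAbs_mk, zpow_natCast]
    exact hmem x
  obtain ⟨q, hq⟩ := h
  exact ⟨q, by simpa using hq.symm⟩

theorem isIntegral_delta (hd : d ∈ K) (n : ℕ) {z : quadRing d} (hz : z ≠ 0) :
    IsIntegral ℤ (delta n z) := by
  have := isPrincipalIdealRing hd
  rw [delta_eq_divisorSum hd _ hz, divisorSum_eq_sum _ _ (Associates.mk_ne_zero.2 hz)]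
  refine IsIntegral.sum _ fun x _ => ?_
  obtain ⟨x, rfl⟩ := Associates.mk_surjective x
  rw [assocAbs_mk, zpow_natCast]
  exact (isIntegral_absVal (neg_of_mem_K hd) x).pow n

/-- A natural number divides another one if the quotient is an algebraic integer. -/
theorem dvd_of_eq_mul_isIntegral {a b : ℕ} (ha : a ≠ 0) {q : ℝ} (hq : IsIntegral ℤ q)
    (h : (b : ℝ) = a * q) : a ∣ b := by
  have ha' : (a : ℝ) ≠ 0 := by exact_mod_cast ha
  have e : q = algebraMap ℚ ℝ (b / a) := by
    rw [eq_comm]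
    simp only [eq_ratCast, Rat.cast_div, Rat.cast_natCast]
    rw [h]
    field_simp
  rw [e, isIntegral_algebraMap_iff (algebraMap ℚ ℝ).injective] at hq
  obtain ⟨y, hy⟩ := IsIntegrallyClosed.isIntegral_iff.1 hq
  have ha'' : (a : ℚ) ≠ 0 := by exact_mod_cast ha
  rw [eq_div_iff ha''] at hy
  have h2 : y * a = b := by
    simp only [eq_intCast] at hy
    exact_mod_cast hy
  exact Int.natCast_dvd_natCast.1 (Dvd.intro_left y h2)

/-- As `δ_n(p ^ k)` is coprime to `|p|` in the ring of all algebraic integers, the equation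
`δ_n(w) |p| ^ (k n) = |w| ^ n δ_n(p ^ k)` forces the norm of `p ^ k` to divide the norm of `w`. -/
theorem norm_pow_dvd_of_abundancy_eq (hd : d ∈ K) {n : ℕ} (hn : n ≠ 0) {p w : quadRing d}
    (hp : Prime p) (hw : w ≠ 0) (k : ℕ) (h : abundancy n w = abundancy n (p ^ k)) {P W : ℕ}
    (hP : absVal p ^ 2 = P) (hW : absVal w ^ 2 = W) : P ^ k ∣ W := by
  have hd0 := neg_of_mem_K hd
  have hp0 := absVal_pos hp.ne_zero
  have hw0 := absVal_pos hw
  have hP0 : P ≠ 0 := by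
    rintro rfl
    exact (pow_pos hp0 2).ne' (by simpa using hP)
  let a : integralClosure ℤ ℝ := ⟨absVal p, isIntegral_absVal hd0 p⟩
  let o : integralClosure ℤ ℝ := ⟨absVal w, isIntegral_absVal hd0 w⟩
  let D : integralClosure ℤ ℝ := ⟨delta n w, isIntegral_delta hd n hw⟩
  -- The sum is `1` modulo `a ^ n`, hence coprime to it.
  have hS : ∑ j ∈ Finset.range (k + 1), (a ^ n) ^ j =
      a ^ n * ∑ j ∈ Finset.range k, (a ^ n) ^ j + 1 := by
    rw [Finset.sum_range_succ', Finset.mul_sum]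
    simp [pow_succ']
  have hco : IsCoprime ((a ^ n) ^ k) (∑ j ∈ Finset.range (k + 1), (a ^ n) ^ j) := by
    refine IsCoprime.pow_left ⟨-∑ j ∈ Finset.range k, (a ^ n) ^ j, 1, ?_⟩
    rw [hS]
    ring
  have heq : (∑ j ∈ Finset.range (k + 1), (a ^ n) ^ j) * o ^ n = (a ^ n) ^ k * D := by
    ext
    have h' := h
    rw [abundancy, abundancy, delta_prime_pow hd _ hp, absVal_pow,
      div_eq_div_iff (by positivity) (by positivity)] at h'
    simp only [zpow_natCast] at h'
    push_cast
    simp only [a, o, D]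
    rw [← h']
    ring
  obtain ⟨q, hq⟩ := hco.dvd_of_dvd_mul_left ⟨D, heq⟩
  have hqR : absVal w ^ n = (absVal p ^ n) ^ k * (q : ℝ) := by
    simpa [a, o] using congrArg Subtype.val hq
  -- Squaring turns the possibly irrational absolute values into integer norms, so divisibility
  -- descends to `ℕ`.
  have hdvd : (P ^ k) ^ n ∣ W ^ n := by
    refine dvd_of_eq_mul_isIntegral (pow_ne_zero _ (pow_ne_zero _ hP0)) (q.2.pow 2) ?_
    push_cast
    rw [← hP, ← hW]
    calc (absVal w ^ 2) ^ n = (absVal w ^ n) ^ 2 := by ring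
      _ = _ := by rw [hqR]; ring
  exact (Nat.pow_dvd_pow_iff hn).1 hdvd

theorem abundancy_prime_pow (hd : d ∈ K) (n : ℕ) {p : quadRing d} (hp : Prime p) (k : ℕ) :
    abundancy n (p ^ k) = ∑ j ∈ Finset.range (k + 1), (absVal p ^ (-n : ℤ)) ^ j := by
  rw [abundancy_eq_delta_neg hd n (pow_ne_zero k hp.ne_zero), delta_prime_pow hd _ hp]

/-- Compares the abundancy of `p ^ (i + j)` with that of `p ^ i * conj p ^ j`. Past exponent `i`,
the left side is `r ^ i` times terms of the last factor, and `r ^ i` is a term of the first. -/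
theorem geom_sum_add_le {r : ℝ} (hr : 0 ≤ r) (i j : ℕ) :
    ∑ l ∈ Finset.range (i + j + 1), r ^ l ≤
      (∑ l ∈ Finset.range (i + 1), r ^ l) * ∑ l ∈ Finset.range (j + 1), r ^ l := by
  have h1 : ∑ l ∈ Finset.range (i + 1 + j), r ^ l = ∑ l ∈ Finset.range (i + 1), r ^ l +
      r ^ i * ∑ l ∈ Finset.range j, r ^ (l + 1) := by
    rw [Finset.sum_range_add, Finset.mul_sum]
    congr 1
    exact Finset.sum_congr rfl fun l _ => by ring
  have h2 : r ^ i ≤ ∑ l ∈ Finset.range (i + 1), r ^ l :=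
    Finset.single_le_sum (f := fun l => r ^ l) (fun l _ => pow_nonneg hr l) (by simp)
  have h3 : 0 ≤ ∑ l ∈ Finset.range j, r ^ (l + 1) := Finset.sum_nonneg fun l _ => by positivity
  rw [show i + j + 1 = i + 1 + j by ring, h1, Finset.sum_range_succ' _ j]
  nlinarith

theorem absVal_eq_of_dvd (hd : d ∈ K) (n : ℕ) {x w : quadRing d} (hw : w ≠ 0) (h : x ∣ w)
    (hle : abundancy n w ≤ abundancy n x) : absVal w = absVal x := by
  have hm := abundancy_mono hd n (ne_zero_of_dvd_ne_zero hw h) hw h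
  exact (absVal_eq_of_associated (neg_of_mem_K hd) (hm.2.1 (le_antisymm hm.1 hle))).symm

theorem exists_pow_dvd_of_pow_dvd_mul (hd : d ∈ K) {p x y : quadRing d} (hp : Prime p) {k : ℕ}
    (h : p ^ k ∣ x * y) : ∃ i j, i + j = k ∧ p ^ i ∣ x ∧ p ^ j ∣ y := by
  have := isPrincipalIdealRing hd
  obtain ⟨a, b, ha, hb, hab⟩ := exists_dvd_and_dvd_of_dvd_mul h
  obtain ⟨i, hi, hia⟩ := (dvd_prime_pow hp k).1 (hab ▸ dvd_mul_right a b)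
  obtain ⟨j, hj, hjb⟩ := (dvd_prime_pow hp k).1 (hab ▸ dvd_mul_left b a)
  refine ⟨i, j, ?_, hia.symm.dvd.trans ha, hjb.symm.dvd.trans hb⟩
  have h1 : Associated (p ^ (i + j)) (p ^ k) := by
    rw [pow_add, hab]
    exact hia.symm.mul_mul hjb.symm
  exact le_antisymm ((pow_dvd_pow_iff hp.ne_zero hp.not_isUnit).1 h1.dvd)
    ((pow_dvd_pow_iff hp.ne_zero hp.not_isUnit).1 h1.symm.dvd)

theorem absVal_eq_of_abundancy_eq_prime_pow (hd : d ∈ K) {n : ℕ} (hn : n ≠ 0) {p w : quadRing d}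
    (hp : Prime p) (hw : w ≠ 0) (k : ℕ) (h : abundancy n w = abundancy n (p ^ k)) :
    absVal w = absVal p ^ k := by
  have := isPrincipalIdealRing hd
  have hd0 := neg_of_mem_K hd
  obtain ⟨P, hP⟩ := exists_absVal_sq_eq hd0 p
  obtain ⟨W, hW⟩ := exists_absVal_sq_eq hd0 w
  set c := conjEquiv hd0 with hc
  have hPc : p * c p = P := mul_conjEquiv hd0 p (by rw [Complex.normSq_eq_norm_sq]; exact hP)
  have hWc : w * c w = W := mul_conjEquiv hd0 w (by rw [Complex.normSq_eq_norm_sq]; exact hW)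
  have hdvd : p ^ k * c p ^ k ∣ w * c w := by
    rw [← mul_pow, hPc, hWc]
    exact_mod_cast Nat.cast_dvd_cast (norm_pow_dvd_of_abundancy_eq hd hn hp hw k h hP hW)
  have hcp : Prime (c p) := (MulEquiv.prime_iff c).2 hp
  have hflip : ∀ j, p ^ j ∣ c w → c p ^ j ∣ w := by
    intro j hj
    have := map_dvd c hj
    rwa [map_pow, hc, conjEquiv_conjEquiv] at this
  have hpow : ∀ j, abundancy n (c p ^ j) = abundancy n (p ^ j) := by
    intro j
    rw [abundancy_prime_pow hd n hcp, abundancy_prime_pow hd n hp, absVal_conjEquiv]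
  -- If `p` is associated to its conjugate, `w * c w` contains `2 k` factors `p`, so `w` or `c w`
  -- contains `k` of them. Otherwise `k` factors suffice: those in `c w` are conjugates of factors
  -- `c p` of `w`, coprime to `p`.
  by_cases hass : Associated p (c p)
  · have h2 : p ^ (k + k) ∣ w * c w := by
      rw [pow_add]
      exact (mul_dvd_mul_left _ (hass.pow_pow).dvd).trans hdvd
    obtain ⟨i, j, hij, hi, hj⟩ := exists_pow_dvd_of_pow_dvd_mul hd hp h2
    rcases (by omega : k ≤ i ∨ k ≤ j) with hk | hk
    · rw [absVal_eq_of_dvd hd n hw ((pow_dvd_pow p hk).trans hi) h.le, absVal_pow]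
    · rw [absVal_eq_of_dvd hd n hw ((pow_dvd_pow (c p) hk).trans (hflip j hj))
        (h.trans (hpow k).symm).le, absVal_pow, absVal_conjEquiv]
  · obtain ⟨i, j, rfl, hi, hj⟩ := exists_pow_dvd_of_pow_dvd_mul hd hp ((dvd_mul_right _ _).trans hdvd)
    have hrel : IsRelPrime (p ^ i) (c p ^ j) :=
      ((hp.irreducible.isRelPrime_iff_not_dvd).2 fun hpc =>
        hass (hp.associated_of_dvd hcp hpc)).pow
    rw [absVal_eq_of_dvd hd n hw (hrel.mul_dvd hi (hflip j hj)), absVal_mul, absVal_pow, absVal_pow,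
      absVal_conjEquiv, pow_add]
    rw [h, abundancy_mul hd n (pow_ne_zero i hp.ne_zero) (pow_ne_zero j hcp.ne_zero) hrel, hpow,
      abundancy_prime_pow hd n hp, abundancy_prime_pow hd n hp, abundancy_prime_pow hd n hp]
    exact geom_sum_add_le (zpow_nonneg (absVal_pos hp.ne_zero).le _) i j

theorem powerfullySolitary_of_associated_prime_pow (hd : d ∈ K) {n : ℕ} (hn : n ≠ 0)
    {z p : quadRing d} {k : ℕ} (hz : z ≠ 0) (hp : Prime p) (h : Associated z (p ^ k)) :
    PowerfullySolitary n z := by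
  refine ⟨hz, ?_⟩
  rintro ⟨w, -, hw, heq, hne⟩
  have h1 : abundancy n z = abundancy n (p ^ k) :=
    (abundancy_mono hd n hz (pow_ne_zero k hp.ne_zero) h.dvd).2.2 h
  apply hne
  rw [absVal_eq_of_abundancy_eq_prime_pow hd hn hp hw k (heq.symm.trans h1), ← absVal_pow]
  exact absVal_eq_of_associated (neg_of_mem_K hd) h

end Abundancy

end QuadAbundancy

open QuadAbundancy in
theorem theorem2p2 (n : ℕ) (hn : 1 ≤ n) (d : ℤ) (hd : d ∈ K) :
    -- (a)
    (∀ z : quadRing d, z ≠ 0 →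
      1 ≤ abundancy n z ∧ (abundancy n z = 1 ↔ IsUnit z) ∧
        (Even n → ∃ q : ℚ, abundancy n z = (q : ℝ))) ∧
    -- (b)
    IsMultiplicative (abundancy n : quadRing d → ℝ) ∧
    -- (c)
    (∀ z : quadRing d, z ≠ 0 → abundancy n z = delta (-(n : ℤ)) z) ∧
    -- (d)
    (∀ z₁ z₂ : quadRing d, z₁ ≠ 0 → z₂ ≠ 0 → z₁ ∣ z₂ →
      abundancy n z₁ ≤ abundancy n z₂ ∧
        (abundancy n z₁ = abundancy n z₂ ↔ Associated z₁ z₂)) ∧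
    -- (e)
    (∀ (z p : quadRing d) (k : ℕ), z ≠ 0 → Prime p → Associated z (p ^ k) →
      PowerfullySolitary n z) := by
  have hn0 : n ≠ 0 := by omega
  refine ⟨fun z hz => ?_, fun x y hx hy h => abundancy_mul hd n hx hy h,
    fun z hz => abundancy_eq_delta_neg hd n hz,
    fun z₁ z₂ h₁ h₂ h => abundancy_mono hd n h₁ h₂ h,
    fun z p k hz hp h => powerfullySolitary_of_associated_prime_pow hd hn0 hz hp h⟩
  -- The lower bound and its equality case are monotonicity along `1 ∣ z`.
  have h := abundancy_mono hd n one_ne_zero hz (one_dvd z)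
  rw [abundancy_one hd n] at h
  refine ⟨h.1, ?_, fun he => exists_rat_abundancy_eq hd he hz⟩
  rw [eq_comm, h.2, ← associated_one_iff_isUnit]
  exact ⟨Associated.symm, Associated.symm⟩
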